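/- Let $X$ be a (real) Banach lattice and let $\mathcal S$ be a semigroup of positive bounded linear operators on $X$, i.e. a set of such operators that is closed under composition. Suppose that (a) $\mathcal S$ is ideal irreducible: no closed (order) ideal of $X$ other than $\{0\}$ and $X$ is invariant under every member of $\mathcal S$; (b) $\mathcal S$ is $\mathbb R_+$-closed: it is closed in the operator norm and $cT\in\mathcal S$ whenever $T\in\mathcal S$ and $c>0$; (c) $\mathcal S$ contains a peripherally Riesz operator, i.e. an operator $T$ with spectral radius $r(T)>0$ whose peripheral spectrum $\sigma_{\rm per}(T)=\{\lambda\in\sigma(T):|\lambda|=r(T)\}$ is separated from the rest of $\sigma(T)$ and has a finite-dimensional spectral subspace (spectrum, spectral projection and spectral subspace being those of the complexification of $T$). Let $\operatorname{minrank}\mathcal S$ denote the minimal rank of the non-zero elements of $\mathcal S$, with $\operatorname{minrank}\mathcal S=+\infty$ if $\mathcal S$ contains no non-zero operator of finite rank. Then $\operatorname{minrank}\mathcal S<+\infty$, and $\mathcal S$ contains a projection $P$ (that is, $P^2=P$) with $\operatorname{rank}P=\operatorname{minrank}\mathcal S$. -/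

import Mathlib

/-! ### Complexification of a real Banach space

The spectrum of an operator on a real Banach space is, as usual, the spectrum of its
complexification. -/

/-- The complexification `X + iX` of a real normed space `X`.  The vector `x + iy` is encoded as the
real-linear map `ℂ → X`, `z ↦ (re z) x - (im z) y`, that is, `z ↦ Re (z (x + iy))`.
The operator norm of this map is Taylor's norm
`‖x + iy‖ = sup { ‖(cos θ) x - (sin θ) y‖ : θ ∈ ℝ }`, and multiplication by a complex number `c`
is `(c • f) z = f (c * z)`. -/
def Complexification (X : Type*) [NormedAddCommGroup X] [NormedSpace ℝ X] : Type _ := ℂ →L[ℝ] X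

namespace Complexification

variable {X : Type*} [NormedAddCommGroup X] [NormedSpace ℝ X]

noncomputable instance : NormedAddCommGroup (Complexification X) :=
  inferInstanceAs (NormedAddCommGroup (ℂ →L[ℝ] X))

instance [CompleteSpace X] : CompleteSpace (Complexification X) :=
  inferInstanceAs (CompleteSpace (ℂ →L[ℝ] X))

noncomputable instance : SMul ℂ (Complexification X) where
  smul c f := ContinuousLinearMap.comp (show ℂ →L[ℝ] X from f) (ContinuousLinearMap.mul ℝ ℂ c)

/-- The element `x + iy` of the complexification. -/
noncomputable def mk (x y : X) : Complexification X :=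
  (Complex.reCLM.smulRight x - Complex.imCLM.smulRight y : ℂ →L[ℝ] X)

/-- Evaluation of the real-linear map `ℂ → X` that encodes an element. -/
noncomputable def eval (f : Complexification X) (z : ℂ) : X := (show ℂ →L[ℝ] X from f) z

theorem ext_eval {f g : Complexification X} (h : ∀ z, f.eval z = g.eval z) : f = g :=
  ContinuousLinearMap.ext (f := (show ℂ →L[ℝ] X from f)) (g := (show ℂ →L[ℝ] X from g)) h

theorem eval_add (f g : Complexification X) (z : ℂ) : (f + g).eval z = f.eval z + g.eval z := rfl

theorem eval_zero (z : ℂ) : (0 : Complexification X).eval z = 0 := rfl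

theorem eval_smul (c : ℂ) (f : Complexification X) (z : ℂ) : (c • f).eval z = f.eval (c * z) := rfl

theorem eval_map_add (f : Complexification X) (z w : ℂ) : f.eval (z + w) = f.eval z + f.eval w :=
  map_add (show ℂ →L[ℝ] X from f) z w

theorem eval_map_zero (f : Complexification X) : f.eval 0 = 0 :=
  map_zero (show ℂ →L[ℝ] X from f)

theorem eval_map_smul (f : Complexification X) (a : ℝ) (z : ℂ) : f.eval (a • z) = a • f.eval z :=
  map_smul (show ℂ →L[ℝ] X from f) a z

theorem eval_mk (x y : X) (z : ℂ) : (mk x y).eval z = z.re • x - z.im • y := rfl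

noncomputable instance : Module ℂ (Complexification X) where
  one_smul f := ext_eval fun z => by rw [eval_smul, one_mul]
  mul_smul a b f := ext_eval fun z => by
    rw [eval_smul, eval_smul, eval_smul, mul_comm a b, mul_assoc]
  smul_zero a := rfl
  smul_add a f g := rfl
  add_smul a b f := ext_eval fun z => by
    rw [eval_add, eval_smul, eval_smul, eval_smul, add_mul, eval_map_add]
  zero_smul f := ext_eval fun z => by rw [eval_smul, zero_mul, eval_map_zero, eval_zero]

noncomputable instance : NormedSpace ℂ (Complexification X) where
  norm_smul_le c f := by
    have h1 := ContinuousLinearMap.opNorm_comp_le (show ℂ →L[ℝ] X from f)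
      (ContinuousLinearMap.mul ℝ ℂ c)
    have h2 := ContinuousLinearMap.opNorm_mul_apply_le ℝ ℂ c
    rw [mul_comm]
    exact h1.trans (mul_le_mul_of_nonneg_left h2 (norm_nonneg f))

/-- Every element has the form `x + iy`. -/
theorem exists_eq_mk (f : Complexification X) : ∃ x y : X, f = mk x y := by
  refine ⟨f.eval 1, -f.eval Complex.I, ext_eval fun z => ?_⟩
  rw [eval_mk, smul_neg, sub_neg_eq_add, ← eval_map_smul, ← eval_map_smul, ← eval_map_add]
  congr 1
  rw [Complex.real_smul, Complex.real_smul, mul_one, Complex.re_add_im]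

/-- `(a + ib)(x + iy) = (ax - by) + i(ay + bx)`. -/
theorem smul_mk (c : ℂ) (x y : X) :
    c • mk x y = mk (c.re • x - c.im • y) (c.re • y + c.im • x) := by
  refine ext_eval fun z => ?_
  rw [eval_smul, eval_mk, eval_mk, Complex.mul_re, Complex.mul_im]
  module

end Complexification

/-- The complexification `x + iy ↦ T x + i T y` of a bounded operator `T`. -/
noncomputable def complexify {X : Type*} [NormedAddCommGroup X] [NormedSpace ℝ X]
    (T : X →L[ℝ] X) : Complexification X →L[ℂ] Complexification X :=
  LinearMap.mkContinuous
    { toFun := fun f => ContinuousLinearMap.comp T (show ℂ →L[ℝ] X from f)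
      map_add' := fun f g => ContinuousLinearMap.comp_add T (show ℂ →L[ℝ] X from f)
        (show ℂ →L[ℝ] X from g)
      map_smul' := fun _ _ => rfl }
    ‖T‖ (fun f => ContinuousLinearMap.opNorm_comp_le T (show ℂ →L[ℝ] X from f))

theorem complexify_mk {X : Type*} [NormedAddCommGroup X] [NormedSpace ℝ X]
    (T : X →L[ℝ] X) (x y : X) :
    complexify T (Complexification.mk x y) = Complexification.mk (T x) (T y) := by
  refine Complexification.ext_eval fun z => ?_
  rw [Complexification.eval_mk]
  change T (z.re • x - z.im • y) = _
  rw [map_sub, map_smul, map_smul]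

/-! ### Peripherally Riesz operators -/

section Spectral

variable {X : Type*} [NormedAddCommGroup X] [NormedSpace ℝ X]

/-- The spectrum `σ(T) ⊆ ℂ` of an operator on a real Banach space. -/
def complexSpectrum (T : X →L[ℝ] X) : Set ℂ := spectrum ℂ (complexify T)

/-- The spectral radius `r(T)`, as a real number (it never exceeds `‖T‖`). -/
noncomputable def specRadius (T : X →L[ℝ] X) : ℝ := (spectralRadius ℂ (complexify T)).toReal

/-- The peripheral spectrum `{λ ∈ σ(T) : |λ| = r(T)}`. -/
def peripheralSpectrum (T : X →L[ℝ] X) : Set ℂ := {z ∈ complexSpectrum T | ‖z‖ = specRadius T}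

/-- The Riesz spectral projection `(2πi)⁻¹ ∮ (z - T)⁻¹ dz` over the positively oriented boundary of
the annulus `ρ < |z| < R`.  It is the spectral projection of `T` for `σ(T) ∩ {ρ < |z| < R}` as soon
as `σ(T)` does not meet the circles `|z| = ρ` and `|z| = R`. -/
noncomputable def annulusSpectralProjection (T : X →L[ℝ] X) (ρ R : ℝ) :
    Complexification X →L[ℂ] Complexification X :=
  (2 * Real.pi * Complex.I : ℂ)⁻¹ •
    ((∮ z in C(0, R), resolvent (complexify T) z) - ∮ z in C(0, ρ), resolvent (complexify T) z)

/-- `T` is peripherally Riesz: `r(T) > 0`, the peripheral spectrum is separated from the rest of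
the spectrum (by some circle `|z| = ρ` with `0 < ρ < r(T)`; recall that the spectrum is compact),
and the peripheral spectral subspace, i.e. the range of the spectral projection for the peripheral
spectrum, is finite-dimensional.  By Cauchy's theorem, that projection does not depend on the
choice of the radii. -/
def IsPeripherallyRiesz (T : X →L[ℝ] X) : Prop :=
  0 < specRadius T ∧
    ∃ ρ R : ℝ, 0 < ρ ∧ ρ < specRadius T ∧ specRadius T < R ∧
      (∀ z ∈ complexSpectrum T, z ∉ peripheralSpectrum T → ‖z‖ < ρ) ∧
      FiniteDimensional ℂ (annulusSpectralProjection T ρ R).range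

/-! ### Semigroups of operators -/

/-- The rank (dimension of the range) of an operator, `⊤` if it is infinite. -/
noncomputable def opRank (T : X →L[ℝ] X) : ℕ∞ :=
  Cardinal.toENat (Module.rank ℝ T.range)

/-- The minimal rank of the non-zero elements of a semigroup; it is `⊤` if there is no non-zero
element of finite rank. -/
noncomputable def minrank (S : Subsemigroup (X →L[ℝ] X)) : ℕ∞ :=
  ⨅ T ∈ S, ⨅ _ : T ≠ 0, opRank T

/-- `ℝ₊`-closed: norm closed and closed under multiplication by positive scalars. -/
def IsRPlusClosed (S : Subsemigroup (X →L[ℝ] X)) : Prop :=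
  IsClosed (S : Set (X →L[ℝ] X)) ∧ ∀ c : ℝ, 0 < c → ∀ T ∈ S, c • T ∈ S

/-- `J` is a closed (order) ideal of the Banach lattice `X`: a norm closed solid subspace. -/
def IsClosedIdeal [Lattice X] (J : Submodule ℝ X) : Prop :=
  IsClosed (J : Set X) ∧ LatticeOrderedAddCommGroup.IsSolid (J : Set X)

/-- Ideal irreducible: no common invariant closed ideals other than `{0}` and `X`. -/
def IsIdealIrreducible [Lattice X] (S : Subsemigroup (X →L[ℝ] X)) : Prop :=
  ∀ J : Submodule ℝ X, IsClosedIdeal J → (∀ T ∈ S, ∀ x ∈ J, T x ∈ J) → J = ⊥ ∨ J = ⊤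

end Spectral

open Filter Topology

/-! ### Contour integrals of the resolvent -/

section Contour

/-! Let `a` be the complexification of a peripherally Riesz `T`, and `Q` its peripheral spectral
projection. Then `a ^ n * (1 - Q)` is `O(ρ ^ n)`, while `‖a ^ n‖` grows at least like `r(T) ^ n`
with `r(T) > ρ`. Normalized powers of `a` are thus asymptotically confined to a finite-dimensional
space of operators and subconverge to a non-zero operator of finite rank. It is the complexification
of an element of `S`, so the minimal rank is finite (`IsPeripherallyRiesz.exists_tendsto`).

Let `A` in `S` have minimal rank. Irreducibility gives `U` in `S` with `A * U * A ≠ 0`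
(`IsIdealIrreducible.exists_mul_mul_ne_zero`). By minimality `B = A * U` has the same range `V` as
`A` and maps `V` onto itself, so `L = B|V` is invertible. Minimality also makes every non-zero limit
of positive multiples of powers of `L` invertible, whence `L⁻¹` is itself such a limit
(`exists_smul_pow_tendsto_inv`). Therefore `L⁻¹ B` lies in `S`, and it is a projection onto `V`
(`exists_isIdempotentElem_of_range_eq`). -/

theorem mul_resolvent_eq {E : Type*} [Ring E] [Algebra ℂ E] {a : E} {z : ℂ}
    (hz : z ∉ spectrum ℂ a) :
    a * resolvent a z = z • resolvent a z - 1 := by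
  have hu : IsUnit (algebraMap ℂ E z - a) := by
    by_contra hn
    exact hz hn
  have h := Ring.mul_inverse_cancel _ hu
  rw [sub_mul, ← Algebra.smul_def] at h
  rw [resolvent, ← h]
  abel

theorem resolvent_mul_eq {E : Type*} [Ring E] [Algebra ℂ E] {a : E} {z : ℂ}
    (hz : z ∉ spectrum ℂ a) :
    resolvent a z * a = z • resolvent a z - 1 := by
  have hu : IsUnit (algebraMap ℂ E z - a) := by
    by_contra hn
    exact hz hn
  have h := Ring.inverse_mul_cancel _ hu
  rw [mul_sub, ← Algebra.commutes, ← Algebra.smul_def] at h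
  rw [resolvent, ← h]
  abel

variable {E : Type*} [NormedRing E] [NormedAlgebra ℂ E] [CompleteSpace E]

theorem ContinuousLinearMap.circleIntegral_comp_comm {F G : Type*} [NormedAddCommGroup F]
    [NormedSpace ℂ F] [NormedAddCommGroup G] [NormedSpace ℂ G] [CompleteSpace F]
    [CompleteSpace G] (φ : F →L[ℂ] G) {f : ℂ → F} {c : ℂ} {R : ℝ} (hf : CircleIntegrable f c R) :
    (∮ z in C(c, R), φ (f z)) = φ (∮ z in C(c, R), f z) := by
  unfold circleIntegral
  rw [← φ.intervalIntegral_comp_comm hf.out]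
  simp only [map_smul]

theorem circleIntegrable_smul_resolvent {a : E} {ρ : ℝ} (hρ : 0 < ρ)
    (h : ∀ z ∈ spectrum ℂ a, ‖z‖ ≠ ρ) {g : ℂ → ℂ} (hg : ContinuousOn g (Metric.sphere 0 ρ)) :
    CircleIntegrable (fun z => g z • resolvent a z) 0 ρ := by
  refine ContinuousOn.circleIntegrable hρ.le (hg.smul fun z hz => ?_)
  refine (spectrum.hasDerivAt_resolvent_const_left ?_).continuousAt.continuousWithinAt
  by_contra hn
  exact h z hn (by simpa using hz)

theorem commute_circleIntegral_resolvent {a : E} {ρ : ℝ} (hρ : 0 < ρ)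
    (h : ∀ z ∈ spectrum ℂ a, ‖z‖ ≠ ρ) : Commute a (∮ z in C(0, ρ), resolvent a z) := by
  have hi : CircleIntegrable (resolvent a) 0 ρ := by
    simpa using circleIntegrable_smul_resolvent hρ h (g := fun _ => 1) continuousOn_const
  have h1 := (ContinuousLinearMap.mul ℂ E a).circleIntegral_comp_comm hi
  have h2 := ((ContinuousLinearMap.mul ℂ E).flip a).circleIntegral_comp_comm hi
  simp only [ContinuousLinearMap.flip_apply, ContinuousLinearMap.mul_apply'] at h1 h2
  rw [Commute, SemiconjBy, ← h1, ← h2]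
  refine circleIntegral.integral_congr hρ.le fun z hz => ?_
  have hz' : z ∉ spectrum ℂ a := fun hn => h z hn (by simpa using hz)
  simp only [mul_resolvent_eq hz', resolvent_mul_eq hz']

/-- Each factor `a` becomes a factor `z` under the integral: the error term in `a R(z) = z R(z) - 1`
contributes `∮ z ^ n dz = 0`. -/
theorem pow_mul_circleIntegral_resolvent {a : E} {ρ : ℝ} (hρ : 0 < ρ)
    (h : ∀ z ∈ spectrum ℂ a, ‖z‖ ≠ ρ) (n : ℕ) :
    a ^ n * (∮ z in C(0, ρ), resolvent a z) = ∮ z in C(0, ρ), z ^ n • resolvent a z := by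
  induction n with
  | zero => simp
  | succ n ih =>
    have hi := circleIntegrable_smul_resolvent hρ h (g := fun z => z ^ n) (by fun_prop)
    have hi' := circleIntegrable_smul_resolvent hρ h (g := fun z => z ^ (n + 1)) (by fun_prop)
    have h1 := (ContinuousLinearMap.mul ℂ E a).circleIntegral_comp_comm hi
    simp only [ContinuousLinearMap.mul_apply'] at h1
    have h0 : (∮ z in C(0, ρ), (z : ℂ) ^ n • (1 : E)) = 0 := by
      rw [circleIntegral.integral_smul_const]
      have := circleIntegral.integral_sub_zpow_of_ne (n := n) (by omega) 0 0 ρ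
      simp only [sub_zero, zpow_natCast] at this
      rw [this, zero_smul]
    rw [pow_succ', mul_assoc, ih, ← h1]
    have hc : CircleIntegrable (fun z : ℂ => z ^ n • (1 : E)) 0 ρ :=
      ContinuousOn.circleIntegrable hρ.le (by fun_prop)
    rw [← sub_zero (∮ z in C(0, ρ), z ^ (n + 1) • resolvent a z), ← h0,
      ← circleIntegral.integral_sub hi' hc]
    refine circleIntegral.integral_congr hρ.le fun z hz => ?_
    have hz' : z ∉ spectrum ℂ a := fun hn => h z hn (by simpa using hz)
    simp only [mul_smul_comm, mul_resolvent_eq hz', smul_sub, smul_smul, pow_succ]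

theorem exists_norm_pow_mul_circleIntegral_resolvent_le {a : E} {ρ : ℝ} (hρ : 0 < ρ)
    (h : ∀ z ∈ spectrum ℂ a, ‖z‖ ≠ ρ) :
    ∃ K : ℝ, ∀ n : ℕ, ‖a ^ n * (∮ z in C(0, ρ), resolvent a z)‖ ≤ K * ρ ^ n := by
  have hc : ContinuousOn (resolvent a) (Metric.sphere (0 : ℂ) ρ) := fun z hz => by
    have hm : z ∈ resolventSet ℂ a := by
      by_contra hn
      exact h z hn (by simpa using hz)
    exact (spectrum.hasDerivAt_resolvent_const_left hm).continuousAt.continuousWithinAt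
  obtain ⟨C, hC⟩ := (isCompact_sphere (0 : ℂ) ρ).exists_bound_of_continuousOn hc
  refine ⟨2 * Real.pi * ρ * C, fun n => ?_⟩
  rw [pow_mul_circleIntegral_resolvent hρ h]
  have hb : ∀ z ∈ Metric.sphere (0 : ℂ) ρ, ‖z ^ n • resolvent a z‖ ≤ ρ ^ n * C := fun z hz => by
    have hz' : ‖z‖ = ρ := by simpa using hz
    rw [norm_smul, norm_pow, hz']
    exact mul_le_mul_of_nonneg_left (hC z hz) (by positivity)
  refine (circleIntegral.norm_integral_le_of_norm_le_const hρ.le hb).trans_eq ?_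
  rw [mul_assoc _ C, mul_comm C]

/-- Split `R(z) = z⁻¹ + a (z⁻¹ R(z))`. The integral of `z⁻¹ R(z)` does not change as the circle
grows, and tends to zero because the resolvent vanishes at infinity. -/
theorem circleIntegral_resolvent_eq {a : E} {R : ℝ} (hR : 0 < R)
    (h : ∀ z ∈ spectrum ℂ a, ‖z‖ < R) :
    (∮ z in C(0, R), resolvent a z) = (2 * Real.pi * Complex.I : ℂ) • (1 : E) := by
  have hd : ∀ z : ℂ, R ≤ ‖z‖ → DifferentiableAt ℂ (fun z : ℂ => z⁻¹ • resolvent a z) z := by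
    intro z hz
    have hz0 : z ≠ 0 := norm_pos_iff.1 (hR.trans_le hz)
    have hm : z ∈ resolventSet ℂ a := by
      by_contra hn
      exact absurd (h z hn) (not_lt.2 hz)
    have hdr : DifferentiableAt ℂ (resolvent a) z :=
      (spectrum.hasDerivAt_resolvent_const_left hm).differentiableAt
    exact (differentiableAt_inv hz0).smul hdr
  have hconst : ∀ R' : ℝ, R ≤ R' → (∮ z in C(0, R'), z⁻¹ • resolvent a z) =
      ∮ z in C(0, R), z⁻¹ • resolvent a z := fun R' hR' => by
    refine Complex.circleIntegral_eq_of_differentiable_on_annulus_off_countable hR hR'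
      (s := ∅) Set.countable_empty (fun z hz => ?_) (fun z hz => ?_)
    · exact (hd z (by simpa using hz.2)).continuousAt.continuousWithinAt
    · exact hd z (by have := hz.1.2; simp at this; exact this.le)
  have hzero : (∮ z in C(0, R), z⁻¹ • resolvent a z) = 0 := by
    rw [← norm_le_zero_iff]
    refine le_of_forall_pos_le_add fun ε hε => ?_
    rw [zero_add]
    have ht := spectrum.resolvent_tendsto_cobounded (𝕜 := ℂ) a
    have hev := ht.eventually (Metric.closedBall_mem_nhds (0 : E)
      (show 0 < ε / (2 * Real.pi) by positivity))
    rw [← comap_norm_atTop, eventually_comap] at hev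
    obtain ⟨R', hR1, hR2⟩ := (hev.and (eventually_ge_atTop R)).exists
    rw [← hconst R' hR2]
    have hp : 0 < R' := hR.trans_le hR2
    calc _ ≤ 2 * Real.pi * R' * (R'⁻¹ * (ε / (2 * Real.pi))) :=
          circleIntegral.norm_integral_le_of_norm_le_const hp.le fun z hz => by
            have hz' : ‖z‖ = R' := by simpa using hz
            rw [norm_smul, norm_inv, hz']
            gcongr
            simpa using hR1 z hz'
      _ = ε := by field_simp
  have hn : ∀ z ∈ spectrum ℂ a, ‖z‖ ≠ R := fun z hz => (h z hz).ne
  have hc : ContinuousOn (fun z : ℂ => z⁻¹) (Metric.sphere 0 R) :=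
    continuousOn_inv₀.mono fun z hz => by
      rintro rfl
      simp at hz
      exact hR.ne hz
  have hi := circleIntegrable_smul_resolvent hR hn hc
  have h1 := (ContinuousLinearMap.mul ℂ E a).circleIntegral_comp_comm hi
  simp only [ContinuousLinearMap.mul_apply', hzero, mul_zero] at h1
  have hi1 : CircleIntegrable (resolvent a) 0 R := by
    simpa using circleIntegrable_smul_resolvent hR hn (g := fun _ => 1) continuousOn_const
  have hi2 : CircleIntegrable (fun z : ℂ => z⁻¹ • (1 : E)) 0 R :=
    ContinuousOn.circleIntegrable hR.le (hc.smul continuousOn_const)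
  have h2 : (∮ z in C(0, R), z⁻¹ • (1 : E)) = (2 * Real.pi * Complex.I : ℂ) • (1 : E) := by
    rw [circleIntegral.integral_smul_const]
    have := circleIntegral.integral_sub_center_inv 0 hR.ne'
    simp only [sub_zero] at this
    rw [this]
  rw [← sub_eq_zero, ← h2, ← circleIntegral.integral_sub hi1 hi2, ← h1]
  refine circleIntegral.integral_congr hR.le fun z hz => ?_
  have hz0 : z ≠ 0 := by
    rintro rfl
    simp at hz
    exact hR.ne hz
  have hz' : z ∉ spectrum ℂ a := fun hm => hn z hm (by simpa using hz)
  simp only [mul_smul_comm, mul_resolvent_eq hz', smul_sub, smul_smul, inv_mul_cancel₀ hz0,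
    one_smul]

theorem norm_pow_le_of_mem_spectrum {a : E} {k : ℂ} (hk : k ∈ spectrum ℂ a) (n : ℕ) :
    ‖k‖ ^ n ≤ ‖a ^ n‖ * ‖(1 : E)‖ := by
  rw [← norm_pow]
  exact spectrum.norm_le_norm_mul_of_mem (spectrum.pow_mem_pow a n hk)

end Contour

/-! ### Normalized powers of a peripherally Riesz operator -/

/-- Only the component along `Q` survives normalization, and it ranges over a bounded set in a
finite-dimensional space of operators. Idempotence of `Q` plays no role. -/
theorem exists_subseq_tendsto_of_finite_rank_part {Y : Type*} [NormedAddCommGroup Y]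
    [NormedSpace ℂ Y] {a Q : Y →L[ℂ] Y} (hcomm : Commute a Q) (hQ : FiniteDimensional ℂ Q.range)
    (ha : ∀ n, a ^ n ≠ 0)
    (hlim : Tendsto (fun n => ‖a ^ n‖⁻¹ * ‖a ^ n * (1 - Q)‖) atTop (𝓝 0)) :
    ∃ (φ : ℕ → ℕ) (N : Y →L[ℂ] Y), StrictMono φ ∧ N ≠ 0 ∧ FiniteDimensional ℂ N.range ∧
      Tendsto (fun k => ((‖a ^ φ k‖⁻¹ : ℝ) : ℂ) • a ^ φ k) atTop (𝓝 N) := by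
  set V := Q.range with hV
  let Q' : Y →L[ℂ] V := Q.codRestrict V fun y => LinearMap.mem_range_self _ y
  let Θ : (V →L[ℂ] V) →ₗ[ℂ] (Y →L[ℂ] Y) :=
    { toFun := fun M => V.subtypeL ∘L M ∘L Q'
      map_add' := fun M M' => by ext y; rfl
      map_smul' := fun c M => by ext y; rfl }
  let W := LinearMap.range Θ
  -- Commuting with `Q`, the power `a ^ n` preserves `V`; its restriction is the required
  -- endomorphism of `V`.
  have hmem : ∀ n, a ^ n * Q ∈ W := fun n => by
    have hinv : ∀ v : V, (a ^ n) v ∈ V := by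
      rintro ⟨_, y, rfl⟩
      exact ⟨(a ^ n) y, (DFunLike.congr_fun (hcomm.pow_left n) y).symm⟩
    exact ⟨((a ^ n) ∘L V.subtypeL).codRestrict V hinv, by ext y; rfl⟩
  have hapos : ∀ n, 0 < ‖a ^ n‖ := fun n => norm_pos_iff.2 (ha n)
  let w : ℕ → W := fun n => ⟨((‖a ^ n‖⁻¹ : ℝ) : ℂ) • (a ^ n * Q), W.smul_mem _ (hmem n)⟩
  have hw : ∀ n, w n ∈ Metric.closedBall (0 : W) ‖Q‖ := fun n => by
    rw [mem_closedBall_zero_iff]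
    change ‖((‖a ^ n‖⁻¹ : ℝ) : ℂ) • (a ^ n * Q)‖ ≤ ‖Q‖
    rw [norm_smul, Complex.norm_real, norm_inv,
      norm_norm, inv_mul_le_iff₀ (hapos n)]
    exact norm_mul_le _ _
  have : ProperSpace W := FiniteDimensional.proper ℂ W
  obtain ⟨N, -, φ, hφ, hN⟩ := tendsto_subseq_of_bounded Metric.isBounded_closedBall hw
  have hN' : Tendsto (fun k => ((‖a ^ φ k‖⁻¹ : ℝ) : ℂ) • (a ^ φ k * Q)) atTop
      (𝓝 (N : Y →L[ℂ] Y)) := (continuous_subtype_val.tendsto N).comp hN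
  have hrest : Tendsto (fun k => ((‖a ^ φ k‖⁻¹ : ℝ) : ℂ) • (a ^ φ k * (1 - Q))) atTop (𝓝 0) := by
    rw [tendsto_zero_iff_norm_tendsto_zero]
    refine (hlim.comp hφ.tendsto_atTop).congr fun k => ?_
    rw [norm_smul, Complex.norm_real, norm_inv, norm_norm, Function.comp]
  have htend : Tendsto (fun k => ((‖a ^ φ k‖⁻¹ : ℝ) : ℂ) • a ^ φ k) atTop
      (𝓝 (N : Y →L[ℂ] Y)) := by
    have := hN'.add hrest
    rw [add_zero] at this
    refine this.congr fun k => ?_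
    rw [← smul_add, ← mul_add, add_sub_cancel, mul_one]
  refine ⟨φ, N, hφ, fun h0 => ?_, ?_, htend⟩
  · have h1 : Tendsto (fun _ : ℕ => (1 : ℝ)) atTop (𝓝 ‖(N : Y →L[ℂ] Y)‖) := by
      refine htend.norm.congr fun k => ?_
      rw [norm_smul, Complex.norm_real, norm_inv, norm_norm, inv_mul_cancel₀ (hapos _).ne']
    rw [h0, norm_zero] at h1
    exact one_ne_zero (tendsto_nhds_unique tendsto_const_nhds h1)
  · obtain ⟨M, hM⟩ := N.2
    refine Submodule.finiteDimensional_of_le (S₂ := V) ?_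
    rw [← hM]
    rintro _ ⟨y, rfl⟩
    exact (M (Q' y)).2

section Complexify

variable {X : Type*} [NormedAddCommGroup X] [NormedSpace ℝ X]

theorem complexify_apply_eval (T : X →L[ℝ] X) (f : Complexification X) (z : ℂ) :
    (complexify T f).eval z = T (f.eval z) := rfl

theorem complexify_mul (T T' : X →L[ℝ] X) :
    complexify (T * T') = complexify T * complexify T' := rfl

theorem complexify_pow (T : X →L[ℝ] X) (n : ℕ) : complexify (T ^ n) = complexify T ^ n := by
  induction n with
  | zero => rfl
  | succ n ih => rw [pow_succ, pow_succ, complexify_mul, ih]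

theorem complexify_sub (T T' : X →L[ℝ] X) :
    complexify (T - T') = complexify T - complexify T' := rfl

theorem complexify_real_smul (c : ℝ) (T : X →L[ℝ] X) :
    complexify (c • T) = (c : ℂ) • complexify T := by
  refine ContinuousLinearMap.ext fun f => Complexification.ext_eval fun z => ?_
  change c • T (f.eval z) = T (f.eval (c * z))
  rw [← Complex.real_smul, Complexification.eval_map_smul, map_smul]

theorem norm_complexify_le (T : X →L[ℝ] X) : ‖complexify T‖ ≤ ‖T‖ :=
  LinearMap.mkContinuous_norm_le _ (norm_nonneg T) _

/-- The embedding `x ↦ x + i0` and evaluation at `1`, which is the real part, are both contractions.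
-/
theorem norm_le_norm_complexify (T : X →L[ℝ] X) : ‖T‖ ≤ ‖complexify T‖ := by
  refine T.opNorm_le_bound (norm_nonneg _) fun x => ?_
  have hx : ‖Complexification.mk x 0‖ ≤ ‖x‖ := by
    refine ContinuousLinearMap.opNorm_le_bound _ (norm_nonneg _) fun z => ?_
    change ‖(Complexification.mk x 0).eval z‖ ≤ _
    rw [Complexification.eval_mk, smul_zero, sub_zero, norm_smul, mul_comm]
    gcongr
    exact Complex.abs_re_le_norm z
  have h1 : T x = (complexify T (Complexification.mk x 0)).eval 1 := by
    rw [complexify_apply_eval, Complexification.eval_mk]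
    simp
  have h2 : ‖(complexify T (Complexification.mk x 0)).eval 1‖ ≤
      ‖complexify T (Complexification.mk x 0)‖ * ‖(1 : ℂ)‖ :=
    ContinuousLinearMap.le_opNorm (show ℂ →L[ℝ] X from _) 1
  rw [h1]
  refine h2.trans ?_
  rw [norm_one, mul_one]
  exact ((complexify T).le_opNorm _).trans (by gcongr)

theorem finiteDimensional_range_of_complexify {T : X →L[ℝ] X}
    (h : FiniteDimensional ℂ (complexify T).range) : FiniteDimensional ℝ T.range := by
  let e : (complexify T).range →ₗ[ℝ] X :=
    { toFun := fun f => f.1.eval 1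
      map_add' := fun f g => rfl
      map_smul' := fun c f => by
        change f.1.eval ((c : ℂ) * 1) = c • f.1.eval 1
        rw [← Complex.real_smul, Complexification.eval_map_smul] }
  have : FiniteDimensional ℝ (complexify T).range := FiniteDimensional.complexToReal _
  refine Submodule.finiteDimensional_of_le (S₂ := LinearMap.range e) ?_
  rintro _ ⟨x, rfl⟩
  refine ⟨⟨complexify T (Complexification.mk x 0), LinearMap.mem_range_self _ _⟩, ?_⟩
  change (complexify T (Complexification.mk x 0)).eval 1 = T x
  rw [complexify_apply_eval, Complexification.eval_mk]
  simp

variable [CompleteSpace X]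

theorem exists_mem_complexSpectrum_norm_eq_specRadius {T : X →L[ℝ] X} (h : 0 < specRadius T) :
    ∃ k ∈ complexSpectrum T, ‖k‖ = specRadius T := by
  have hne : (complexSpectrum T).Nonempty := by
    by_contra hn
    rw [Set.not_nonempty_iff_eq_empty, complexSpectrum] at hn
    simp [specRadius, spectralRadius, hn] at h
  obtain ⟨k, hk, hk'⟩ := spectrum.exists_nnnorm_eq_spectralRadius_of_nonempty hne
  exact ⟨k, hk, by rw [specRadius, ← hk']; simp⟩

theorem norm_le_specRadius {T : X →L[ℝ] X} {z : ℂ} (hz : z ∈ complexSpectrum T) :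
    ‖z‖ ≤ specRadius T := by
  obtain ⟨k, -, hk'⟩ := spectrum.exists_nnnorm_eq_spectralRadius_of_nonempty ⟨z, hz⟩
  have h1 : (‖z‖₊ : ENNReal) ≤ spectralRadius ℂ (complexify T) :=
    le_iSup₂ (α := ENNReal) (f := fun (k : ℂ) (_ : k ∈ spectrum ℂ (complexify T)) => (‖k‖₊ : ENNReal))
      z hz
  rw [specRadius, ← hk']
  rw [← hk'] at h1
  exact_mod_cast ENNReal.coe_le_coe.1 h1

theorem IsPeripherallyRiesz.exists_tendsto {T : X →L[ℝ] X} (hT : IsPeripherallyRiesz T) :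
    ∃ (φ : ℕ → ℕ) (c : ℕ → ℝ) (N : X →L[ℝ] X), StrictMono φ ∧ (∀ k, 0 < c k) ∧ N ≠ 0 ∧
      FiniteDimensional ℝ N.range ∧ Tendsto (fun k => c k • T ^ φ k) atTop (𝓝 N) := by
  obtain ⟨hr, ρ, R, hρ, hρr, hrR, hsep, hfin⟩ := hT
  set a := complexify T with ha
  obtain ⟨k, hk, hkr⟩ := exists_mem_complexSpectrum_norm_eq_specRadius hr
  have hR : 0 < R := hr.trans hrR
  have hspecR : ∀ z ∈ spectrum ℂ a, ‖z‖ < R := fun z hz => (norm_le_specRadius hz).trans_lt hrR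
  have hspecρ : ∀ z ∈ spectrum ℂ a, ‖z‖ ≠ ρ := fun z hz => by
    by_cases hp : z ∈ peripheralSpectrum T
    · exact (hρr.trans_eq hp.2.symm).ne'
    · exact (hsep z hz hp).ne
  set Q := annulusSpectralProjection T ρ R with hQ
  have hpi : (2 * Real.pi * Complex.I : ℂ) ≠ 0 := Complex.two_pi_I_ne_zero
  -- The outer circle encloses the whole spectrum, so its integral contributes the identity.
  have hone : 1 - Q = (2 * Real.pi * Complex.I : ℂ)⁻¹ • ∮ z in C(0, ρ), resolvent a z := by
    rw [hQ, annulusSpectralProjection, ← ha, circleIntegral_resolvent_eq hR hspecR, smul_sub,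
      smul_smul, inv_mul_cancel₀ hpi, one_smul, sub_sub_cancel]
  have hcomm : Commute a Q := by
    have h1 : Commute a (1 - Q) := by
      rw [hone]
      exact (commute_circleIntegral_resolvent hρ hspecρ).smul_right _
    simpa using (Commute.one_right a).sub_right h1
  obtain ⟨K, hK⟩ := exists_norm_pow_mul_circleIntegral_resolvent_le hρ hspecρ
  have hlow : ∀ n, specRadius T ^ n ≤ ‖a ^ n‖ * ‖(1 : Complexification X →L[ℂ] _)‖ := fun n => by
    rw [← hkr]
    exact norm_pow_le_of_mem_spectrum hk n
  have hane : ∀ n, a ^ n ≠ 0 := fun n h0 => by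
    have := hlow n
    rw [h0, norm_zero, zero_mul] at this
    exact absurd (pow_pos hr n) (not_lt.2 this)
  have hlim : Tendsto (fun n => ‖a ^ n‖⁻¹ * ‖a ^ n * (1 - Q)‖) atTop (𝓝 0) := by
    set C := ‖(2 * Real.pi * Complex.I : ℂ)⁻¹‖
    set D := ‖(1 : Complexification X →L[ℂ] Complexification X)‖
    have hg : Tendsto (fun n : ℕ => D * C * K * (ρ / specRadius T) ^ n) atTop (𝓝 0) := by
      have := (tendsto_pow_atTop_nhds_zero_of_lt_one (by positivity)
        ((div_lt_one hr).2 hρr)).const_mul (D * C * K)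
      rwa [mul_zero] at this
    refine squeeze_zero (fun n => by positivity) (fun n => ?_) hg
    have hp : 0 < ‖a ^ n‖ := norm_pos_iff.2 (hane n)
    have hrn : 0 < specRadius T ^ n := pow_pos hr n
    have h2 : ‖a ^ n * (1 - Q)‖ ≤ C * (K * ρ ^ n) := by
      rw [hone, mul_smul_comm, norm_smul]
      exact mul_le_mul_of_nonneg_left (hK n) (norm_nonneg _)
    have hinv : ‖a ^ n‖⁻¹ ≤ D * (specRadius T ^ n)⁻¹ := by
      rw [inv_le_iff_one_le_mul₀ hp, mul_right_comm, ← div_eq_mul_inv, le_div_iff₀ hrn, one_mul,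
        mul_comm]
      exact hlow n
    calc _ ≤ D * (specRadius T ^ n)⁻¹ * (C * (K * ρ ^ n)) :=
          mul_le_mul hinv h2 (norm_nonneg _) (by positivity)
      _ = _ := by rw [div_pow]; ring
  obtain ⟨φ, N, hφ, hN0, hNfin, hN⟩ :=
    exists_subseq_tendsto_of_finite_rank_part hcomm hfin hane hlim
  have hN' : Tendsto (fun k => complexify (‖a ^ φ k‖⁻¹ • T ^ φ k)) atTop (𝓝 N) :=
    hN.congr fun k => by rw [complexify_real_smul, complexify_pow]
  -- The scalars are real, so the sequence consists of complexified operators; as complexification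
  -- is isometric, the limit descends to `X`.
  have hcauchy : CauchySeq fun k => ‖a ^ φ k‖⁻¹ • T ^ φ k := by
    rw [Metric.cauchySeq_iff']
    intro ε hε
    obtain ⟨n, hn⟩ := Metric.cauchySeq_iff'.1 hN'.cauchySeq ε hε
    refine ⟨n, fun m hm => lt_of_le_of_lt ?_ (hn m hm)⟩
    rw [dist_eq_norm, dist_eq_norm, ← complexify_sub]
    exact norm_le_norm_complexify _
  obtain ⟨N₀, hN₀⟩ := cauchySeq_tendsto_of_complete hcauchy
  have hcN : complexify N₀ = N := by
    refine tendsto_nhds_unique ?_ hN'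
    rw [tendsto_iff_norm_sub_tendsto_zero] at hN₀ ⊢
    refine squeeze_zero (fun _ => norm_nonneg _) (fun k => ?_) hN₀
    rw [← complexify_sub]
    exact norm_complexify_le _
  refine ⟨φ, fun k => ‖a ^ φ k‖⁻¹, N₀, hφ, fun k => inv_pos.2 (norm_pos_iff.2 (hane _)), ?_, ?_,
    hN₀⟩
  · rintro rfl
    exact hN0 (hcN.symm.trans rfl)
  · exact finiteDimensional_range_of_complexify (hcN ▸ hNfin)

end Complexify

/-! ### Null ideals of positive operators -/

section PositiveOperator

theorem abs_real_smul_le {X : Type*} [AddCommGroup X] [Lattice X] [Module ℝ X]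
    [IsOrderedModule ℝ X] (c : ℝ) (x : X) : |c • x| ≤ |c| • |x| := by
  have h : ∀ (d : ℝ) (y : X), d • y ≤ |d| • |y| := fun d y => by
    rcases le_total 0 d with hd | hd
    · rw [abs_of_nonneg hd]
      exact smul_le_smul_of_nonneg_left (le_abs_self y) hd
    · rw [abs_of_nonpos hd, ← neg_smul_neg]
      exact smul_le_smul_of_nonneg_left (neg_le_abs y) (neg_nonneg.2 hd)
  refine sup_le (h c x) ?_
  rw [← smul_neg, ← abs_neg x]
  exact h c (-x)

variable {X : Type*} [NormedAddCommGroup X] [Lattice X] [IsOrderedAddMonoid X] [NormedSpace ℝ X]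

theorem ContinuousLinearMap.monotone_of_nonneg {T : X →L[ℝ] X} (hT : ∀ x, 0 ≤ x → 0 ≤ T x) :
    Monotone T := fun x y hxy => by
  have := hT (y - x) (sub_nonneg.2 hxy)
  rwa [map_sub, sub_nonneg] at this

theorem ContinuousLinearMap.abs_apply_le_of_nonneg {T : X →L[ℝ] X} (hT : ∀ x, 0 ≤ x → 0 ≤ T x)
    (x : X) : |T x| ≤ T |x| :=
  sup_le (monotone_of_nonneg hT (le_abs_self x))
    (by rw [← map_neg]; exact monotone_of_nonneg hT (neg_le_abs x))

theorem ContinuousLinearMap.eq_zero_of_nonneg_apply_eq_zero {T : X →L[ℝ] X}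
    (h : ∀ x, 0 ≤ x → T x = 0) : T = 0 := by
  ext x
  rw [← posPart_sub_negPart x, map_sub, h _ (posPart_nonneg x), h _ (negPart_nonneg x)]
  simp

end PositiveOperator

section NullIdeal

variable {X : Type*} [NormedAddCommGroup X] [Lattice X] [HasSolidNorm X] [IsOrderedAddMonoid X]
  [NormedSpace ℝ X] [IsOrderedModule ℝ X]

/-- The common null ideal `{x | A |x| = 0 for all A ∈ 𝒜}` of a set of positive operators. -/
def nullIdeal (𝒜 : Set (X →L[ℝ] X)) (h𝒜 : ∀ A ∈ 𝒜, ∀ x, 0 ≤ x → 0 ≤ A x) : Submodule ℝ X where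
  carrier := {x | ∀ A ∈ 𝒜, A |x| = 0}
  zero_mem' := fun A _ => by rw [abs_zero, map_zero]
  add_mem' := fun {x y} hx hy A hA => by
    refine le_antisymm ?_ (h𝒜 A hA _ (abs_nonneg _))
    refine (ContinuousLinearMap.monotone_of_nonneg (h𝒜 A hA) (abs_add_le x y)).trans ?_
    rw [map_add, hx A hA, hy A hA, add_zero]
  smul_mem' := fun c x hx A hA => by
    refine le_antisymm ?_ (h𝒜 A hA _ (abs_nonneg _))
    refine (ContinuousLinearMap.monotone_of_nonneg (h𝒜 A hA) (abs_real_smul_le c x)).trans ?_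
    rw [map_smul, hx A hA, smul_zero]

theorem isClosedIdeal_nullIdeal {𝒜 : Set (X →L[ℝ] X)} (h𝒜 : ∀ A ∈ 𝒜, ∀ x, 0 ≤ x → 0 ≤ A x) :
    IsClosedIdeal (nullIdeal 𝒜 h𝒜) := by
  refine ⟨?_, fun x hx y hxy A hA => ?_⟩
  · have : ((nullIdeal 𝒜 h𝒜 : Submodule ℝ X) : Set X) = ⋂ A ∈ 𝒜, {x | A |x| = 0} := by
      ext x
      simp [nullIdeal]
    rw [this]
    refine isClosed_biInter fun A _ => isClosed_eq (A.continuous.comp ?_) continuous_const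
    exact continuous_id.sup continuous_neg
  · refine le_antisymm ?_ (h𝒜 A hA _ (abs_nonneg _))
    rw [← hx A hA]
    exact ContinuousLinearMap.monotone_of_nonneg (h𝒜 A hA) hxy

/-- If a set of positive operators is stable, up to zero products, under right multiplication by the
members of an ideal irreducible semigroup, and all its elements vanish at a common non-zero positive
vector, then all its elements are zero. -/
theorem IsIdealIrreducible.eq_zero_of_apply_eq_zero {S : Subsemigroup (X →L[ℝ] X)}
    (hirr : IsIdealIrreducible S) (hpos : ∀ T ∈ S, ∀ x : X, 0 ≤ x → 0 ≤ T x)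
    {𝒜 : Set (X →L[ℝ] X)} (h𝒜 : ∀ A ∈ 𝒜, ∀ x, 0 ≤ x → 0 ≤ A x)
    (hinv : ∀ A ∈ 𝒜, ∀ T ∈ S, A * T = 0 ∨ A * T ∈ 𝒜)
    {x₀ : X} (hx₀ : 0 ≤ x₀) (hne : x₀ ≠ 0) (hx : ∀ A ∈ 𝒜, A x₀ = 0) : ∀ A ∈ 𝒜, A = 0 := by
  have hJ := hirr (nullIdeal 𝒜 h𝒜) (isClosedIdeal_nullIdeal h𝒜) fun T hT x hxJ A hA => by
    refine le_antisymm ?_ (h𝒜 A hA _ (abs_nonneg _))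
    refine (ContinuousLinearMap.monotone_of_nonneg (h𝒜 A hA)
      (ContinuousLinearMap.abs_apply_le_of_nonneg (hpos T hT) x)).trans ?_
    change (A * T) |x| ≤ 0
    rcases hinv A hA T hT with h | h
    · rw [h]; exact le_rfl
    · exact (hxJ _ h).le
  have hmem : x₀ ∈ nullIdeal 𝒜 h𝒜 := fun A hA => by rw [abs_of_nonneg hx₀, hx A hA]
  rcases hJ with h | h
  · rw [h] at hmem
    exact absurd hmem hne
  · intro A hA
    refine ContinuousLinearMap.eq_zero_of_nonneg_apply_eq_zero fun x hx => ?_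
    have hxJ : x ∈ nullIdeal 𝒜 h𝒜 := h ▸ Submodule.mem_top
    rw [← abs_of_nonneg hx]
    exact hxJ A hA

/-- Otherwise take `x ≥ 0` with `A x ≠ 0`. All products `A * T` kill `A x`, and their common null
ideal is invariant, so they all vanish. Then the null ideal of `A` alone is invariant and contains
`A x`, forcing `A = 0`. -/
theorem IsIdealIrreducible.exists_mul_mul_ne_zero {S : Subsemigroup (X →L[ℝ] X)}
    (hirr : IsIdealIrreducible S) (hpos : ∀ T ∈ S, ∀ x : X, 0 ≤ x → 0 ≤ T x)
    {A : X →L[ℝ] X} (hA : A ∈ S) (hA0 : A ≠ 0) : ∃ T ∈ S, A * T * A ≠ 0 := by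
  by_contra! hcon
  obtain ⟨x, hx, hAx⟩ : ∃ x, 0 ≤ x ∧ A x ≠ 0 := by
    by_contra! h
    exact hA0 (ContinuousLinearMap.eq_zero_of_nonneg_apply_eq_zero h)
  have h1 : ∀ B ∈ {B | ∃ T ∈ S, A * T = B}, B = 0 := by
    refine hirr.eq_zero_of_apply_eq_zero hpos ?_ ?_ (hpos A hA x hx) hAx ?_
    · rintro _ ⟨T, hT, rfl⟩
      exact hpos _ (S.mul_mem hA hT)
    · rintro _ ⟨T, hT, rfl⟩ T' hT'
      exact Or.inr ⟨T * T', S.mul_mem hT hT', (mul_assoc _ _ _).symm⟩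
    · rintro _ ⟨T, hT, rfl⟩
      exact DFunLike.congr_fun (hcon T hT) x
  refine hA0 (hirr.eq_zero_of_apply_eq_zero hpos (𝒜 := {A}) ?_ ?_ (hpos A hA x hx) hAx ?_ A
    (Set.mem_singleton A))
  · rintro _ ⟨⟩
    exact hpos A hA
  · rintro _ ⟨⟩ T hT
    exact Or.inl (h1 _ ⟨T, hT, rfl⟩)
  · rintro _ ⟨⟩
    exact DFunLike.congr_fun (h1 _ ⟨A, hA, rfl⟩) x

end NullIdeal

/-! ### Rank -/

section Rank

variable {X : Type*} [NormedAddCommGroup X] [NormedSpace ℝ X]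

theorem opRank_lt_top_iff {T : X →L[ℝ] X} : opRank T < ⊤ ↔ FiniteDimensional ℝ T.range := by
  rw [opRank, Cardinal.toENat_lt_top, Module.rank_lt_aleph0_iff]

theorem opRank_eq_finrank {T : X →L[ℝ] X} [FiniteDimensional ℝ T.range] :
    opRank T = Module.finrank ℝ T.range := by
  rw [opRank, ← Module.finrank_eq_rank, Cardinal.toENat_nat]

/-- This is how minimality of rank is exploited: a non-zero element of `S` cannot shrink a range of
minimal dimension. -/
theorem range_eq_of_le_of_opRank_le {A B : X →L[ℝ] X} [FiniteDimensional ℝ A.range]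
    (h : B.range ≤ A.range) (hr : opRank A ≤ opRank B) : B.range = A.range := by
  have : FiniteDimensional ℝ B.range := Submodule.finiteDimensional_of_le h
  rw [opRank_eq_finrank, opRank_eq_finrank, Nat.cast_le] at hr
  exact Submodule.eq_of_le_of_finrank_le h hr

theorem minrank_le {S : Subsemigroup (X →L[ℝ] X)} {T : X →L[ℝ] X} (hT : T ∈ S) (h0 : T ≠ 0) :
    minrank S ≤ opRank T :=
  iInf_le_of_le T (iInf_le_of_le hT (iInf_le _ h0))

theorem exists_opRank_eq_minrank {S : Subsemigroup (X →L[ℝ] X)} (h : ∃ T ∈ S, T ≠ 0) :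
    ∃ A ∈ S, A ≠ 0 ∧ opRank A = minrank S := by
  obtain ⟨T, hT, hT0⟩ := h
  obtain ⟨A, hA, hmin⟩ := exists_minimalFor_of_wellFoundedLT (fun T => T ∈ S ∧ T ≠ 0) opRank
    ⟨T, hT, hT0⟩
  refine ⟨A, hA.1, hA.2, le_antisymm ?_ (minrank_le hA.1 hA.2)⟩
  refine le_iInf fun B => le_iInf fun hB => le_iInf fun hB0 => ?_
  rcases le_total (opRank B) (opRank A) with hle | hle
  · exact hmin ⟨hB, hB0⟩ hle
  · exact hle

end Rank

/-! ### Recurrence of powers in a finite-dimensional algebra -/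

/-- Normalized powers subconverge to some `C ≠ 0`, invertible by `hcl`. Quotients of consecutive
terms of the subsequence then tend to `C C⁻¹ = 1`; dividing once more by `v` gives the claim. -/
theorem exists_smul_pow_tendsto_inv {E : Type*} [NormedRing E] [NormedAlgebra ℝ E]
    [FiniteDimensional ℝ E] (v : Eˣ) (hE : (1 : E) ≠ 0)
    (hcl : ∀ (φ : ℕ → ℕ) (c : ℕ → ℝ) (C : E), (∀ k, 0 < c k) → C ≠ 0 →
      Tendsto (fun k => c k • (v : E) ^ φ k) atTop (𝓝 C) → IsUnit C) :
    ∃ (m : ℕ → ℕ) (c : ℕ → ℝ), (∀ k, 0 < c k) ∧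
      Tendsto (fun k => c k • (v : E) ^ m k) atTop (𝓝 ((v⁻¹ : Eˣ) : E)) := by
  obtain ⟨L, hv⟩ : ∃ L : E, L = v := ⟨_, rfl⟩
  rw [← hv] at hcl ⊢
  have hL : IsUnit L := hv ▸ v.isUnit
  have : ProperSpace E := FiniteDimensional.proper ℝ E
  have : CompleteSpace E := FiniteDimensional.complete ℝ E
  have : Nontrivial E := ⟨1, 0, hE⟩
  have hpos : ∀ n, 0 < ‖L ^ n‖ := fun n => norm_pos_iff.2 (hL.pow n).ne_zero
  have hnorm : ∀ n, ‖‖L ^ n‖⁻¹ • L ^ n‖ = 1 := fun n => by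
    rw [norm_smul, norm_inv, norm_norm, inv_mul_cancel₀ (hpos n).ne']
  obtain ⟨C, -, φ, hφ, hC⟩ := tendsto_subseq_of_bounded
    (x := fun n => ‖L ^ n‖⁻¹ • L ^ n) (s := Metric.closedBall 0 1) Metric.isBounded_closedBall
    fun n => mem_closedBall_zero_iff.2 (hnorm n).le
  have hC0 : C ≠ 0 := by
    rintro rfl
    have h1 := hC.norm
    simp only [Function.comp, hnorm, norm_zero] at h1
    exact one_ne_zero (tendsto_nhds_unique tendsto_const_nhds h1)
  obtain ⟨u, hu⟩ := hcl φ (fun k => ‖L ^ φ k‖⁻¹) C (fun k => inv_pos.2 (hpos _)) hC0 hC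
  have hinv : Tendsto (fun k => Ring.inverse (‖L ^ φ k‖⁻¹ • L ^ φ k)) atTop (𝓝 ↑u⁻¹) := by
    have := NormedRing.inverse_continuousAt u
    rw [ContinuousAt, Ring.inverse_unit, hu] at this
    exact this.comp hC
  have hinv_eq : ∀ k, Ring.inverse (‖L ^ φ k‖⁻¹ • L ^ φ k) = ‖L ^ φ k‖ • ((v ^ φ k)⁻¹ : Eˣ).val := by
    intro k
    have h0 := (hpos (φ k)).ne'
    have h1 : (‖L ^ φ k‖⁻¹ • L ^ φ k) * (‖L ^ φ k‖ • ((v ^ φ k)⁻¹ : Eˣ).val) = 1 := by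
      rw [smul_mul_smul_comm, inv_mul_cancel₀ h0, one_smul, hv, ← Units.val_pow_eq_pow_val,
        Units.mul_inv]
    have hu' : IsUnit (‖L ^ φ k‖⁻¹ • L ^ φ k) := (hL.pow _).smul (Units.mk0 _ (inv_ne_zero h0))
    rw [← one_mul (‖L ^ φ k‖ • _), ← Ring.inverse_mul_cancel _ hu', mul_assoc, h1, mul_one]
  -- The final `- 1` is the extra division by `v`. Strict monotonicity of `φ` prevents truncation,
  -- but the exponent may be zero.
  refine ⟨fun k => φ (k + 1) - φ k - 1, fun k => ‖L ^ φ (k + 1)‖⁻¹ * ‖L ^ φ k‖,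
    fun k => mul_pos (inv_pos.2 (hpos _)) (hpos _), ?_⟩
  have hprod := ((hC.comp (tendsto_add_atTop_nat 1)).mul hinv).mul_const ((v⁻¹ : Eˣ) : E)
  rw [← hu, Units.mul_inv, one_mul] at hprod
  refine hprod.congr fun k => ?_
  have hlt : φ k < φ (k + 1) := hφ k.lt_succ_self
  have hexp : φ (k + 1) = (φ (k + 1) - φ k - 1 + 1) + φ k := by omega
  have hL' : L ^ φ (k + 1) * ((v ^ φ k)⁻¹ : Eˣ).val * ((v⁻¹ : Eˣ) : E) =
      L ^ (φ (k + 1) - φ k - 1) := by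
    rw [hv]
    conv_lhs => rw [hexp]
    rw [pow_add, mul_assoc (_ ^ _), ← Units.val_pow_eq_pow_val v (φ k), Units.mul_inv, mul_one,
      pow_succ, mul_assoc, Units.mul_inv, mul_one]
  rw [hinv_eq]
  simp only [Function.comp]
  rw [smul_mul_smul_comm, smul_mul_assoc, hL']

/-! ### Minimal projections -/

section Minimal

variable {X : Type*} [NormedAddCommGroup X] [NormedSpace ℝ X]

theorem Subsemigroup.pow_succ_mem {M : Type*} [Monoid M] (S : Subsemigroup M) {a : M} (ha : a ∈ S)
    (n : ℕ) : a ^ (n + 1) ∈ S := by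
  induction n with
  | zero => simpa using ha
  | succ n ih => rw [pow_succ]; exact S.mul_mem ih ha

/-- The map `Θ M = M ∘ B` transports endomorphisms of `V` to operators on `X`. The projection is `Θ
L⁻¹`, the identity on `V`. -/
theorem exists_isIdempotentElem_of_range_eq {S : Subsemigroup (X →L[ℝ] X)}
    (hclosed : IsRPlusClosed S) {B : X →L[ℝ] X} (hB : B ∈ S) (hB0 : B ≠ 0)
    [FiniteDimensional ℝ B.range] (hrank : opRank B = minrank S)
    (hsurj : ∀ v ∈ B.range, ∃ w ∈ B.range, B w = v) :
    ∃ P ∈ S, IsIdempotentElem P ∧ opRank P = minrank S := by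
  set V := B.range with hV
  let B' : X →L[ℝ] V := B.codRestrict V fun y => LinearMap.mem_range_self _ y
  let L : V →L[ℝ] V := B' ∘L V.subtypeL
  let Θ : (V →L[ℝ] V) →ₗ[ℝ] (X →L[ℝ] X) :=
    { toFun := fun M => V.subtypeL ∘L M ∘L B'
      map_add' := fun M M' => by ext y; rfl
      map_smul' := fun c M => by ext y; rfl }
  have hΘc : Continuous Θ := LinearMap.continuous_of_finiteDimensional Θ
  have hB'surj : Function.Surjective B' := by
    rintro ⟨_, x, rfl⟩
    exact ⟨x, rfl⟩
  have hΘ0 : ∀ M, Θ M = 0 → M = 0 := fun M hM => by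
    ext v
    obtain ⟨x, rfl⟩ := hB'surj v
    exact DFunLike.congr_fun hM x
  have hΘrange : ∀ M, (Θ M).range ≤ B.range := fun M => by
    rintro _ ⟨x, rfl⟩
    exact (M (B' x)).2
  -- Because of the shift, even exponent zero yields an element of `S`, which need not contain the
  -- identity.
  have hΘpow : ∀ n, Θ (L ^ n) = B ^ (n + 1) := fun n => by
    induction n with
    | zero => rw [pow_zero, zero_add, pow_one]; rfl
    | succ n ih => rw [pow_succ' B, ← ih, pow_succ']; rfl
  have hΘrank : ∀ M, Θ M ∈ S → M ≠ 0 → (Θ M).range = B.range := fun M hM hM0 =>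
    range_eq_of_le_of_opRank_le (hΘrange M)
      (hrank.trans_le (minrank_le hM fun h => hM0 (hΘ0 M h)))
  have hunit : ∀ M : V →L[ℝ] V, Function.Surjective M → IsUnit M := fun M hM =>
    ContinuousLinearMap.isUnit_iff_bijective.2
      ⟨LinearMap.injective_iff_surjective (f := (M : V →ₗ[ℝ] V)) |>.2 hM, hM⟩
  have hL : IsUnit L := hunit L <| by
    rintro ⟨v, hv⟩
    obtain ⟨w, hw, rfl⟩ := hsurj v hv
    exact ⟨⟨w, hw⟩, rfl⟩
  have hone : (1 : V →L[ℝ] V) ≠ 0 := fun h => hB0 <| by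
    have h1 := hΘpow 0
    rw [pow_zero, h, map_zero, zero_add, pow_one] at h1
    exact h1.symm
  obtain ⟨u, hu⟩ := hL
  have hmem : ∀ (φ : ℕ → ℕ) (c : ℕ → ℝ) (C : V →L[ℝ] V), (∀ k, 0 < c k) →
      Tendsto (fun k => c k • (u : V →L[ℝ] V) ^ φ k) atTop (𝓝 C) → Θ C ∈ S := by
    intro φ c C hc hC
    refine hclosed.1.mem_of_tendsto ((hΘc.tendsto C).comp hC) (Eventually.of_forall fun k => ?_)
    change Θ (c k • (u : V →L[ℝ] V) ^ φ k) ∈ S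
    rw [map_smul, hu, hΘpow]
    exact hclosed.2 _ (hc k) _ (S.pow_succ_mem hB _)
  -- `Θ C` is a non-zero element of `S`, so by minimality its range is all of `V`; hence `C` is
  -- onto, and invertible in finite dimension.
  have hcl : ∀ (φ : ℕ → ℕ) (c : ℕ → ℝ) (C : V →L[ℝ] V), (∀ k, 0 < c k) → C ≠ 0 →
      Tendsto (fun k => c k • (u : V →L[ℝ] V) ^ φ k) atTop (𝓝 C) → IsUnit C := by
    intro φ c C hc hC0 hC
    refine hunit C ?_
    rintro ⟨v, hv⟩
    rw [hV, ← hΘrank C (hmem φ c C hc hC) hC0] at hv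
    obtain ⟨x, rfl⟩ := hv
    exact ⟨B' x, Subtype.ext rfl⟩
  obtain ⟨m, c, hc, hlim⟩ := exists_smul_pow_tendsto_inv (E := V →L[ℝ] V) u hone hcl
  replace hmem := hmem m c _ hc hlim
  have hne : ((u⁻¹ : (V →L[ℝ] V)ˣ) : V →L[ℝ] V) ≠ 0 := fun h => hone <| by
    rw [← Units.mul_inv u, h, mul_zero]
  refine ⟨_, hmem, ?_, ?_⟩
  · ext x
    change ((u⁻¹ : (V →L[ℝ] V)ˣ) : V →L[ℝ] V) (L (((u⁻¹ : (V →L[ℝ] V)ˣ) : V →L[ℝ] V) (B' x))) =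
      (((u⁻¹ : (V →L[ℝ] V)ˣ) : V →L[ℝ] V) (B' x) : X)
    rw [← hu]
    exact congrArg Subtype.val (DFunLike.congr_fun (Units.inv_mul u) _)
  · rw [← hrank, opRank, opRank, hΘrank _ hmem hne]

end Minimal

theorem mainTheorem4 {X : Type*} [NormedAddCommGroup X] [Lattice X] [HasSolidNorm X]
    [IsOrderedAddMonoid X] [NormedSpace ℝ X] [IsOrderedModule ℝ X] [CompleteSpace X]
    (S : Subsemigroup (X →L[ℝ] X))
    (hpos : ∀ T ∈ S, ∀ x : X, 0 ≤ x → 0 ≤ T x)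
    (hirr : IsIdealIrreducible S)
    (hclosed : IsRPlusClosed S)
    (hriesz : ∃ T ∈ S, IsPeripherallyRiesz T) :
    minrank S < ⊤ ∧ ∃ P ∈ S, IsIdempotentElem P ∧ opRank P = minrank S := by
  obtain ⟨T, hT, hTR⟩ := hriesz
  obtain ⟨φ, c, N, hφ, hc, hN0, hNfin, hN⟩ := hTR.exists_tendsto
  have hNS : N ∈ S := by
    -- The index `k = 0` is dropped because `φ 0` may be `0` and `T ^ 0` need not lie in `S`.
    refine hclosed.1.mem_of_tendsto hN ((eventually_ge_atTop 1).mono fun k hk => ?_)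
    obtain ⟨j, hj⟩ := Nat.exists_eq_add_of_le' (hk.trans (hφ.id_le k))
    rw [hj]
    exact hclosed.2 _ (hc k) _ (S.pow_succ_mem hT j)
  have hfin : minrank S < ⊤ := (minrank_le hNS hN0).trans_lt (opRank_lt_top_iff.2 hNfin)
  refine ⟨hfin, ?_⟩
  obtain ⟨A, hA, hA0, hAr⟩ := exists_opRank_eq_minrank ⟨N, hNS, hN0⟩
  have : FiniteDimensional ℝ A.range := opRank_lt_top_iff.1 (hAr ▸ hfin)
  -- `A` itself may vanish on its own range; passing to `A * U` repairs this.
  obtain ⟨U, hU, hne⟩ := hirr.exists_mul_mul_ne_zero hpos hA hA0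
  have hAU : A * U ∈ S := S.mul_mem hA hU
  have hAU0 : A * U ≠ 0 := fun h => hne (by rw [h, zero_mul])
  have hr1 : (A * U).range = A.range := by
    refine range_eq_of_le_of_opRank_le ?_ (hAr.trans_le (minrank_le hAU hAU0))
    rintro _ ⟨x, rfl⟩
    exact ⟨U x, rfl⟩
  have hr2 : (A * U * A).range = A.range := by
    refine range_eq_of_le_of_opRank_le ?_ (hAr.trans_le (minrank_le (S.mul_mem hAU hA) hne))
    rintro _ ⟨x, rfl⟩
    exact ⟨U (A x), rfl⟩
  have : FiniteDimensional ℝ (A * U).range := hr1 ▸ inferInstance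
  refine exists_isIdempotentElem_of_range_eq hclosed hAU hAU0 ?_ fun v hv => ?_
  · rw [← hAr, opRank, opRank, hr1]
  · rw [hr1] at hv ⊢
    rw [← hr2] at hv
    obtain ⟨x, rfl⟩ := hv
    exact ⟨A x, LinearMap.mem_range_self _ x, rfl⟩
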